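/- Let $G=(\mathcal V,\mathcal E)$ be a finite connected simple graph with $N$ nodes, and let $p\ge 0$. A $ZY_p$ ansatz on $G$ consists of $p$ rounds; in each round every edge of $G$ receives an orientation $a\to b$, and the edges are listed in an order; orientation and order are arbitrary and may differ from round to round. For angles $\boldsymbol\theta=(\theta_0,\dots,\theta_{p-1})\in\mathbb R^p$, the oriented edge $a\to b$ in round $l$ stands for the gate $e^{-i\theta_l Z_aY_b/2}$. Let $U_1,\dots,U_L$ be all gates in the order in which they act, and $|\phi_p(\boldsymbol\theta)\rangle=U_L\cdots U_1|+\rangle^{\otimes N}$. Fix an edge $(i,j)\in\mathcal E$ and $k\ge 0$. A Pauli path is a sequence $s=(s_0,\dots,s_L)$ of normalized Pauli strings (elements of $\{I/\sqrt2,X/\sqrt2,Y/\sqrt2,Z/\sqrt2\}^{\otimes N}$). For $v\subseteq\mathcal V$ let $\sigma_X|_v$ be the Pauli-$X$ string supported on $v$, and $$c_{s,v}(\boldsymbol\theta)=\operatorname{tr}(Z_iZ_js_L)\Big[\prod_{m=1}^{L}\operatorname{tr}(U_m^\dagger s_mU_ms_{m-1})\Big]\operatorname{tr}(s_0\,\sigma_X|_v),$$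 so that $\langle\phi_p(\boldsymbol\theta)|Z_iZ_j|\phi_p(\boldsymbol\theta)\rangle=2^{-N}\sum_{v,s}c_{s,v}(\boldsymbol\theta)$. The gate $U_m$ is relevant for $s$ if $s_{m-1}\ne s_m$. The $k$-local subgraph $G^k_{(i,j)}$ consists of the edge $(i,j)$ and of all nodes and edges lying on walks of length at most $k$ that start at $i$ or at $j$. A path is truncated if some relevant gate of it sits on an edge outside $G^k_{(i,j)}$. The $k$-local expectation $\langle\phi_p(\boldsymbol\theta)|Z_iZ_j|\phi_p(\boldsymbol\theta)\rangle_k$ is $2^{-N}$ times the sum over $v$ and over all paths that are not truncated of $c_{s,v}(\boldsymbol\theta)$, where for each gate $U_m=e^{-i\theta_lZ_aY_b/2}$ whose nodes $a,b$ both lie in $G^k_{(i,j)}$ but whose edge does not, the factor $\operatorname{tr}(U_m^\dagger s_mU_ms_{m-1})$ is replaced by the product of the two corresponding factors of the gates $e^{-i\theta_lZ_aY_\kappa/2}$ and $e^{-i\theta_lZ_{\kappa'}Y_b/2}$ with additional isolated nodes $\kappa,\kappa'$, neither of which transforms the string ($s_m$ being extended by the identity to $\kappa,\kappa'$). The relevant-gate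 graph of $s$ is the undirected multigraph with one edge $\{a,b\}$ for every relevant gate $e^{-i\theta_l Z_aY_b/2}$ of $s$ and one additional edge $\{i,j\}$; its nodes are the endpoints of these edges. Then there is a constant $C$, depending only on the node set $\mathcal V$ and on $p$ (not on the edges of $G$, the ansatz, $(i,j)$, $k$ or $\boldsymbol\theta$), such that the following two statements hold. 1. For all $\boldsymbol\theta$ with $\|\boldsymbol\theta\|_\infty\le\pi/2$, and also for all $\boldsymbol\theta$ of arbitrary size whose entries are all equal, $$\big|\langle\phi_p(\boldsymbol\theta)|Z_iZ_j|\phi_p(\boldsymbol\theta)\rangle_k-\langle\phi_p(\boldsymbol\theta)|Z_iZ_j|\phi_p(\boldsymbol\theta)\rangle\big|\le C\,\big|\sin\|\boldsymbol\theta\|_\infty\big|^{2k+1}.$$ 2. For every $\boldsymbol\theta$ and $v$, every truncated Pauli path $s$ with $c_{s,v}(\boldsymbol\theta)\neq0$ has a relevant-gate graph that is 2-edge-connected (it is connected, and stays connected when any one edge is removed) and has at least $2k+2$ edges, counted with multiplicity. -/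

import Mathlib

open scoped Matrix

noncomputable section

namespace ZY

/-! ### Pauli strings and their matrices -/

/-- The four single-qubit Pauli letters. -/
inductive Pauli where
  | I
  | X
  | Y
  | Z
  deriving DecidableEq

instance : Fintype Pauli where
  elems := {.I, .X, .Y, .Z}
  complete := by rintro (_ | _ | _ | _) <;> simp

/-- The matrix of a Pauli letter. -/
def Pauli.mat : Pauli → Matrix (Fin 2) (Fin 2) ℂ
  | .I => 1
  | .X => !![0, 1; 1, 0]
  | .Y => !![0, -Complex.I; Complex.I, 0]
  | .Z => !![1, 0; 0, -1]

/-- Operators on the qubits labelled by `V`, in the computational basis `V → Fin 2`. -/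
abbrev Op (V : Type*) : Type _ := Matrix (V → Fin 2) (V → Fin 2) ℂ

/-- A Pauli string: one Pauli letter for every node. -/
abbrev PauliString (V : Type*) : Type _ := V → Pauli

variable {V : Type*} [Fintype V] [DecidableEq V]

/-- The tensor product `⨂ᵥ s(v)` of the letters of a Pauli string. -/
def PauliString.op (s : PauliString V) : Op V :=
  Matrix.of fun a b => ∏ v, (s v).mat (a v) (b v)

/-- The normalized Pauli string `⨂ᵥ s(v) / √2`. -/
def PauliString.normOp (s : PauliString V) : Op V :=
  (((Real.sqrt 2 : ℝ) : ℂ)⁻¹ ^ Fintype.card V) • s.op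

/-- The string with letter `P` on node `a`, letter `Q` on node `b`, and `I` elsewhere
(used for `a ≠ b`). -/
def twoSite (P : Pauli) (a : V) (Q : Pauli) (b : V) : PauliString V :=
  fun v => if v = a then P else if v = b then Q else Pauli.I

/-- The Pauli-`X` string supported on the set `v` of nodes. -/
def xString (v : Finset V) : PauliString V :=
  fun w => if w ∈ v then Pauli.X else Pauli.I

/-- The gate `exp(-i t Z_a Y_b / 2)`. -/
def gateOp (t : ℝ) (a b : V) : Op V :=
  NormedSpace.exp ((-(Complex.I * (t : ℂ) / 2)) • (twoSite Pauli.Z a Pauli.Y b).op)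

/-- The product state `|+⟩^{⊗V}`. -/
def plusState (V : Type*) [Fintype V] : (V → Fin 2) → ℂ :=
  fun _ => ((Real.sqrt 2 : ℝ) : ℂ)⁻¹ ^ Fintype.card V

/-! ### The ansatz -/

/-- The data of a `ZY_p` ansatz on `G`. Each of the `p` rounds is a list of directed edges in which
every undirected edge of `G` occurs exactly once. The direction of the dart `a → b` is the `ZY`
orientation of the edge (gate `exp(-i θ_l Z_a Y_b / 2)`), and the order of the list is the gate
sequence of the round; both may differ from round to round. -/
structure Ansatz (G : SimpleGraph V) (p : ℕ) where
  /-- the oriented edges of round `l`, in order -/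
  round : Fin p → List G.Dart
  nodup : ∀ l, ((round l).map SimpleGraph.Dart.edge).Nodup
  mem_iff : ∀ l e, e ∈ (round l).map SimpleGraph.Dart.edge ↔ e ∈ G.edgeSet

namespace Ansatz

variable {G : SimpleGraph V} {p : ℕ} (A : Ansatz G p)

/-- All gates of the circuit (round and oriented edge), in the order in which they act on the
input state. -/
def gates : List (Fin p × G.Dart) :=
  (List.finRange p).flatMap fun l => (A.round l).map fun e => (l, e)

/-- The total number `L` of gates. -/
def numGates : ℕ := A.gates.length

/-- The round of the gate number `m`. -/
def gateRound (m : Fin A.numGates) : Fin p := (A.gates.get m).1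

/-- The node of gate number `m` that carries the `Z`. -/
def gateZ (m : Fin A.numGates) : V := (A.gates.get m).2.fst

/-- The node of gate number `m` that carries the `Y`. -/
def gateY (m : Fin A.numGates) : V := (A.gates.get m).2.snd

/-- The unitary of gate number `m`. -/
def gateU (θ : Fin p → ℝ) (m : Fin A.numGates) : Op V :=
  gateOp (θ (A.gateRound m)) (A.gateZ m) (A.gateY m)

/-- The circuit `U = U_L ⋯ U_2 U_1`. -/
def circuit (θ : Fin p → ℝ) : Op V := (List.ofFn (A.gateU θ)).reverse.prod

/-- The ansatz state `U |+⟩^{⊗V}`. -/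
def state (θ : Fin p → ℝ) : (V → Fin 2) → ℂ := A.circuit θ *ᵥ plusState V

/-- The exact expectation of `Z_i Z_j` in the ansatz state. -/
def expectation (θ : Fin p → ℝ) (i j : V) : ℂ :=
  star (A.state θ) ⬝ᵥ ((twoSite Pauli.Z i Pauli.Z j).op *ᵥ A.state θ)

/-! ### Pauli paths -/

/-- A Pauli path `(s_0, …, s_L)`. -/
abbrev Path : Type _ := Fin (A.numGates + 1) → PauliString V

/-- The contribution
`tr(Z_i Z_j s_L) [∏ₘ tr(U_m† s_m U_m s_{m-1})] tr(s_0 σ_X|_v)` of a Pauli path. -/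
def contribution (θ : Fin p → ℝ) (i j : V) (v : Finset V) (s : A.Path) : ℂ :=
  ((twoSite Pauli.Z i Pauli.Z j).op * (s (Fin.last _)).normOp).trace *
    (∏ m : Fin A.numGates,
      ((A.gateU θ m)ᴴ * (s m.succ).normOp * A.gateU θ m * (s m.castSucc).normOp).trace) *
    ((s 0).normOp * (xString v).op).trace

/-- Gate number `m` is relevant for the path: it transforms the Pauli string. -/
def Relevant (s : A.Path) (m : Fin A.numGates) : Prop := s m.succ ≠ s m.castSucc

end Ansatz

/-! ### The `k`-local subgraph and the `k`-local analysis -/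

/-- The `k`-local subgraph of the edge `{i, j}`: this edge, and all nodes and edges that can be
reached from `i` or from `j` by a walk of at most `k` steps. For `k = 0` its only edge is
`{i, j}`. -/
def kLocal (G : SimpleGraph V) (i j : V) (k : ℕ) : G.Subgraph where
  verts := {x | ∃ c, (c = i ∨ c = j) ∧ ∃ w : G.Walk c x, w.length ≤ k}
  Adj x y := G.Adj x y ∧ (s(x, y) = s(i, j) ∨
    ∃ c, (c = i ∨ c = j) ∧ ∃ (z : V) (w : G.Walk c z), w.length ≤ k ∧ s(x, y) ∈ w.edges)
  adj_sub h := h.1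
  edge_vert := by
    rintro x y ⟨-, h | ⟨c, hc, z, w, hw, he⟩⟩
    · refine ⟨x, ?_, SimpleGraph.Walk.nil, by simp⟩
      rcases Sym2.eq_iff.1 h with h | h
      · exact Or.inl h.1
      · exact Or.inr h.1
    · have hx := w.fst_mem_support_of_mem_edges he
      exact ⟨c, hc, w.takeUntil x hx, (w.length_takeUntil_le_length hx).trans hw⟩
  symm := ⟨by
    rintro x y ⟨hxy, h⟩
    refine ⟨hxy.symm, ?_⟩
    rwa [Sym2.eq_swap]⟩

/-- The factor of a gate `exp(-i t Z_a Y_b / 2)` that is replaced by the two gates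
`exp(-i t Z_a Y_κ / 2)` and `exp(-i t Z_κ' Y_b / 2)`, where `κ`, `κ'` are two additional isolated
nodes, for a path that stays at the string `s` (extended by `I` on `κ`, `κ'`) at both gates. -/
def splitFactor (t : ℝ) (a b : V) (s : PauliString V) : ℂ :=
  let r : PauliString (V ⊕ Bool) := Sum.elim s fun _ => Pauli.I
  let U : Op (V ⊕ Bool) := gateOp t (Sum.inl a) (Sum.inr false)
  let U' : Op (V ⊕ Bool) := gateOp t (Sum.inr true) (Sum.inl b)
  (Uᴴ * r.normOp * U * r.normOp).trace * (U'ᴴ * r.normOp * U' * r.normOp).trace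

namespace Ansatz

variable {G : SimpleGraph V} {p : ℕ} (A : Ansatz G p)

/-- The edge of gate number `m` belongs to the `k`-local subgraph. -/
def IsLocalGate (i j : V) (k : ℕ) (m : Fin A.numGates) : Prop :=
  (kLocal G i j k).Adj (A.gateZ m) (A.gateY m)

/-- Both nodes of gate number `m` belong to the `k`-local subgraph, but its edge does not. -/
def IsChordGate (i j : V) (k : ℕ) (m : Fin A.numGates) : Prop :=
  A.gateZ m ∈ (kLocal G i j k).verts ∧ A.gateY m ∈ (kLocal G i j k).verts ∧
    ¬ A.IsLocalGate i j k m

/-- The path is truncated in the `k`-local analysis: it is transformed by a gate that does not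
belong to the `k`-local subgraph. -/
def Truncated (i j : V) (k : ℕ) (s : A.Path) : Prop :=
  ∃ m, A.Relevant s m ∧ ¬ A.IsLocalGate i j k m

open Classical in
/-- The contribution of a path that is not truncated to the `k`-local expectation: chord gates are
split, all other factors are unchanged. -/
def kLocalContribution (θ : Fin p → ℝ) (i j : V) (k : ℕ) (v : Finset V) (s : A.Path) : ℂ :=
  ((twoSite Pauli.Z i Pauli.Z j).op * (s (Fin.last _)).normOp).trace *
    (∏ m : Fin A.numGates,
      if A.IsChordGate i j k m then
        splitFactor (θ (A.gateRound m)) (A.gateZ m) (A.gateY m) (s m.succ)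
      else
        ((A.gateU θ m)ᴴ * (s m.succ).normOp * A.gateU θ m * (s m.castSucc).normOp).trace) *
    ((s 0).normOp * (xString v).op).trace

open Classical in
/-- The `k`-local expectation of `Z_i Z_j`: the expansion of the expectation over Pauli paths, with
`d = 2^N`, in which the truncated paths are discarded. -/
def kLocalExpectation (θ : Fin p → ℝ) (i j : V) (k : ℕ) : ℂ :=
  (1 / 2 ^ Fintype.card V) * ∑ v : Finset V, ∑ s : A.Path,
    if A.Truncated i j k s then 0 else A.kLocalContribution θ i j k v s

/-! ### The relevant-gate graph -/

/-- The undirected relevant-gate multigraph of the path extended by one further relevant gate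
`exp(-i θ Z_i Y_j / 2)`: there is one edge `some m` for every relevant gate `m` of the path, joining
the two nodes of that gate, and the edge `none`, joining `i` and `j`, for the additional gate; the
nodes are the endpoints of these edges. -/
def relevantGraph (i j : V) (s : A.Path) : Graph V (Option (Fin A.numGates)) where
  vertexSet := {x | x = i ∨ x = j ∨ ∃ m, A.Relevant s m ∧ (x = A.gateZ m ∨ x = A.gateY m)}
  IsLink e x y := match e with
    | none => s(x, y) = s(i, j)
    | some m => A.Relevant s m ∧ s(x, y) = s(A.gateZ m, A.gateY m)
  isLink_symm := by
    rintro (_ | m) -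
    · exact ⟨fun x y h => by simpa only [Sym2.eq_swap] using h⟩
    · exact ⟨fun x y h => by simpa only [Sym2.eq_swap] using h⟩
  eq_or_eq_of_isLink_of_isLink := by
    rintro (_ | m) x y u w h h'
    · have := h.trans h'.symm
      rcases Sym2.eq_iff.1 this with h | h
      · exact Or.inl h.1
      · exact Or.inr h.1
    · have := h.2.trans h'.2.symm
      rcases Sym2.eq_iff.1 this with h | h
      · exact Or.inl h.1
      · exact Or.inr h.1
  left_mem_of_isLink := by
    rintro (_ | m) x y h
    · rcases Sym2.eq_iff.1 h with h | h
      · exact Or.inl h.1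
      · exact Or.inr (Or.inl h.1)
    · rcases Sym2.eq_iff.1 h.2 with h' | h'
      · exact Or.inr (Or.inr ⟨m, h.1, Or.inl h'.1⟩)
      · exact Or.inr (Or.inr ⟨m, h.1, Or.inr h'.1⟩)

end Ansatz

/-- A multigraph is connected: it is non-empty, and any two nodes are joined by a walk. -/
def GraphConnected {α β : Type*} (H : Graph α β) : Prop :=
  H.vertexSet.Nonempty ∧
    ∀ x ∈ H.vertexSet, ∀ y ∈ H.vertexSet, Relation.ReflTransGen H.Adj x y

/-- A multigraph is 2-edge-connected: it is connected, and remains so (on the same nodes) when any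
one of its edges is removed. -/
def TwoEdgeConnected {α β : Type*} (H : Graph α β) : Prop :=
  GraphConnected H ∧ ∀ e ∈ H.edgeSet, GraphConnected (H.deleteEdges {e})

end ZY

end

/-! In the Heisenberg picture, a gate with generator `P = Z_a Y_b` fixes a Pauli string that
commutes with `P`, and sends an anticommuting string `S` to `cos θ • S + i sin θ • P S`. A nonzero
path therefore starts at `Z_i Z_j`, is multiplied by `P` (up to phase) at each relevant gate, gains
a factor `± sin θ` there, and ends in a string of letters `I`, `X`, because `|+⟩⟨+|` on all nodes is
a multiple of the sum of all `X`-strings.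

The key invariant is the parity, on a node set `S`, of the letters `Y` and `Z`. A generator changes
it exactly when its edge crosses `S`. It begins as the crossing parity of `{i, j}` and ends at 0, so
every cut of the relevant-gate graph is even (`IsAllowed.even_edgeCut`). The graph is connected,
since a gate can only act where it meets the support; hence it has no bridge.

Now take levels by distance to `{i, j}`. A node at level at least `k` makes each of the `k` cuts
between consecutive levels nonempty, hence of size at least 2, which gives `2k` gates. A truncated
path has one further gate beyond these cuts, so it is `O(r^(2k+1))`, where `r` bounds all the sines.
Splitting a chord matters only when both its ends, at level at least `k`, lie in the support: the
path then has `2k` sines, and the correction costs `O(r^2)`. Finitely many paths are summed. -/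

namespace ZY

open Matrix

/-! ### Pauli strings: products, commutation signs, traces, completeness -/

section PauliAlgebra

/-- The tensor product of a family of one-qubit operators. -/
def tensor {V : Type*} [Fintype V] (f : V → Matrix (Fin 2) (Fin 2) ℂ) : Op V :=
  Matrix.of fun a b => ∏ v, f v (a v) (b v)

variable {V : Type*} [Fintype V]

theorem PauliString.op_eq_tensor (s : PauliString V) : s.op = tensor fun v => (s v).mat := rfl

theorem tensor_mul [DecidableEq V] (f g : V → Matrix (Fin 2) (Fin 2) ℂ) :
    tensor f * tensor g = tensor fun v => f v * g v := by
  ext a b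
  simp only [tensor, Matrix.mul_apply, Matrix.of_apply, ← Finset.prod_mul_distrib]
  rw [Finset.prod_univ_sum, Fintype.piFinset_univ]

theorem trace_tensor [DecidableEq V] (f : V → Matrix (Fin 2) (Fin 2) ℂ) :
    (tensor f).trace = ∏ v, (f v).trace := by
  simp only [tensor, Matrix.trace, Matrix.diag_apply, Matrix.of_apply]
  rw [Finset.prod_univ_sum, Fintype.piFinset_univ]

theorem tensor_conjTranspose (f : V → Matrix (Fin 2) (Fin 2) ℂ) :
    (tensor f)ᴴ = tensor fun v => (f v)ᴴ := by
  ext a b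
  simp [tensor, Matrix.conjTranspose_apply]

theorem tensor_one [DecidableEq V] : tensor (fun _ : V => (1 : Matrix (Fin 2) (Fin 2) ℂ)) = 1 := by
  ext a b
  simp only [tensor, Matrix.of_apply, Matrix.one_apply]
  rw [Finset.prod_ite_zero]
  simp [funext_iff]

theorem tensor_smul (c : V → ℂ) (f : V → Matrix (Fin 2) (Fin 2) ℂ) :
    tensor (fun v => c v • f v) = (∏ v, c v) • tensor f := by
  ext a b
  simp [tensor, Finset.prod_mul_distrib]

namespace Pauli

/-- The product of two Pauli letters up to a phase. -/
def mulLetter : Pauli → Pauli → Pauli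
  | I, Q => Q
  | P, I => P
  | X, X => I
  | X, Y => Z
  | X, Z => Y
  | Y, X => Z
  | Y, Y => I
  | Y, Z => X
  | Z, X => Y
  | Z, Y => X
  | Z, Z => I

/-- The sign with which two Pauli letters commute. -/
def sgn (P Q : Pauli) : ℂ := if P = I ∨ Q = I ∨ P = Q then 1 else -1

theorem sgn_eq (P Q : Pauli) : sgn P Q = 1 ∨ sgn P Q = -1 := by
  unfold sgn; split <;> simp

theorem mat_mul_comm (P Q : Pauli) : P.mat * Q.mat = sgn P Q • (Q.mat * P.mat) := by
  cases P <;> cases Q <;> ext a b <;> fin_cases a <;> fin_cases b <;>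
    simp [mat, sgn, Matrix.mul_apply]

theorem mat_mul_self (P : Pauli) : P.mat * P.mat = 1 := by
  cases P <;> ext a b <;> fin_cases a <;> fin_cases b <;> simp [mat, Matrix.mul_apply]

theorem mat_conjTranspose (P : Pauli) : P.matᴴ = P.mat := by
  cases P <;> ext a b <;> fin_cases a <;> fin_cases b <;> simp [mat]

theorem trace_mat_mul (P Q : Pauli) : (P.mat * Q.mat).trace = if P = Q then 2 else 0 := by
  cases P <;> cases Q <;> simp [mat, Matrix.trace] <;> norm_num

/-- Only the norm is recorded: phases of Pauli products play no role in the estimates, so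
`mulLetter` may forget them. -/
theorem norm_trace_mat_mul_mat_mul (P Q R : Pauli) :
    ‖(P.mat * Q.mat * R.mat).trace‖ = if R = mulLetter P Q then 2 else 0 := by
  cases P <;> cases Q <;> cases R <;>
    simp [mat, mulLetter, Matrix.trace, ← two_mul]

/-- Completeness on one qubit: `∑ P ⊗ P` is twice the swap operator. Taking products over nodes
gives completeness of the Pauli strings. -/
theorem sum_mat_mul_mat (a b c d : Fin 2) :
    ∑ P : Pauli, P.mat a b * P.mat c d = if a = d ∧ b = c then 2 else 0 := by
  have : (Finset.univ : Finset Pauli) = {I, X, Y, Z} := rfl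
  rw [this]
  fin_cases a <;> fin_cases b <;> fin_cases c <;> fin_cases d <;> simp [mat] <;> norm_num

end Pauli

/-- The letterwise product of two Pauli strings up to a phase. -/
def PauliString.mulString (s t : PauliString V) : PauliString V := fun v => (s v).mulLetter (t v)

/-- The sign with which two Pauli strings commute. -/
def PauliString.sgn (s t : PauliString V) : ℂ := ∏ v, (s v).sgn (t v)

theorem PauliString.op_conjTranspose (s : PauliString V) : s.opᴴ = s.op := by
  simp only [PauliString.op_eq_tensor, tensor_conjTranspose, Pauli.mat_conjTranspose]

theorem PauliString.sgn_eq (s t : PauliString V) : s.sgn t = 1 ∨ s.sgn t = -1 := by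
  unfold PauliString.sgn
  refine Finset.prod_induction _ (fun z : ℂ => z = 1 ∨ z = -1) ?_ (Or.inl rfl)
    fun v _ => Pauli.sgn_eq _ _
  rintro a b (rfl | rfl) (rfl | rfl) <;> simp

variable [DecidableEq V]

theorem PauliString.op_mul_comm (s t : PauliString V) :
    s.op * t.op = s.sgn t • (t.op * s.op) := by
  simp only [PauliString.op_eq_tensor, tensor_mul, PauliString.sgn, ← tensor_smul]
  congr 1
  ext1 v
  exact Pauli.mat_mul_comm _ _

theorem PauliString.op_mul_self (s : PauliString V) : s.op * s.op = 1 := by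
  simp only [PauliString.op_eq_tensor, tensor_mul, Pauli.mat_mul_self, tensor_one]

theorem PauliString.trace_op_mul_op (s t : PauliString V) :
    (s.op * t.op).trace = if s = t then 2 ^ Fintype.card V else 0 := by
  simp only [PauliString.op_eq_tensor, tensor_mul, trace_tensor, Pauli.trace_mat_mul]
  rw [Finset.prod_ite_zero]
  simp [funext_iff]

theorem PauliString.norm_trace_op_mul_op_mul_op (s t r : PauliString V) :
    ‖(s.op * t.op * r.op).trace‖ = if r = s.mulString t then 2 ^ Fintype.card V else 0 := by
  simp only [PauliString.op_eq_tensor, tensor_mul, trace_tensor, norm_prod,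
    Pauli.norm_trace_mat_mul_mat_mul]
  rw [Finset.prod_ite_zero]
  simp [funext_iff, PauliString.mulString]

theorem inv_sqrt_two_pow_mul_self (n : ℕ) :
    ((Real.sqrt 2 : ℝ) : ℂ)⁻¹ ^ n * ((Real.sqrt 2 : ℝ) : ℂ)⁻¹ ^ n = (1 / 2 ^ n : ℂ) := by
  have h : ((Real.sqrt 2 : ℝ) : ℂ) * ((Real.sqrt 2 : ℝ) : ℂ) = 2 := by
    rw [← Complex.ofReal_mul, Real.mul_self_sqrt (by norm_num)]; simp
  rw [← mul_pow, ← mul_inv, h, inv_pow, one_div]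

theorem PauliString.trace_normOp_mul_normOp (s t : PauliString V) :
    (s.normOp * t.normOp).trace = if s = t then 1 else 0 := by
  simp only [PauliString.normOp, smul_mul_smul_comm, Matrix.trace_smul, smul_eq_mul,
    PauliString.trace_op_mul_op, inv_sqrt_two_pow_mul_self]
  split <;> simp

theorem PauliString.norm_trace_op_mul_normOp_mul_normOp (s t r : PauliString V) :
    ‖(s.op * t.normOp * r.normOp).trace‖ = if r = s.mulString t then 1 else 0 := by
  simp only [PauliString.normOp, mul_smul_comm, smul_mul_assoc, Matrix.trace_smul, smul_eq_mul]
  rw [← mul_assoc, inv_sqrt_two_pow_mul_self, norm_mul,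
    PauliString.norm_trace_op_mul_op_mul_op]
  split <;> simp

theorem PauliString.trace_op_mul_normOp_eq_zero {s t : PauliString V} (h : t ≠ s) :
    (s.op * t.normOp).trace = 0 := by
  simp [PauliString.normOp, PauliString.trace_op_mul_op, h.symm]

theorem PauliString.norm_trace_op_mul_normOp_le (s t : PauliString V) :
    ‖(s.op * t.normOp).trace‖ ≤ 2 ^ Fintype.card V := by
  simp only [PauliString.normOp, mul_smul_comm, Matrix.trace_smul, smul_eq_mul,
    PauliString.trace_op_mul_op, norm_mul, norm_pow, norm_inv]
  have h1 : ‖((Real.sqrt 2 : ℝ) : ℂ)‖⁻¹ ^ Fintype.card V ≤ 1 := by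
    refine pow_le_one₀ (by positivity) (inv_le_one_of_one_le₀ ?_)
    rw [Complex.norm_real, Real.norm_of_nonneg (Real.sqrt_nonneg _)]
    exact Real.one_le_sqrt.2 (by norm_num)
  have h2 : ‖(if s = t then 2 ^ Fintype.card V else 0 : ℂ)‖ ≤ 2 ^ Fintype.card V := by
    split <;> simp
  exact (mul_le_mul h1 h2 (norm_nonneg _) zero_le_one).trans_eq (one_mul _)

/-- The normalized Pauli strings are an orthonormal basis of the operators. -/
theorem sum_trace_mul_normOp_smul (M : Op V) :
    ∑ s : PauliString V, (M * s.normOp).trace • s.normOp = M := by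
  have key (a b c d : V → Fin 2) : ∑ s : PauliString V, s.op a b * s.op c d =
      if a = d ∧ b = c then 2 ^ Fintype.card V else 0 := by
    simp only [PauliString.op, Matrix.of_apply, ← Finset.prod_mul_distrib]
    have := Finset.prod_univ_sum (fun _ : V => (Finset.univ : Finset Pauli))
      (fun v P => P.mat (a v) (b v) * P.mat (c v) (d v))
    rw [Fintype.piFinset_univ] at this
    rw [← this]
    simp only [Pauli.sum_mat_mul_mat]
    rw [Finset.prod_ite_zero]
    simp [funext_iff, forall_and]
  ext c d
  simp only [PauliString.normOp, mul_smul_comm, Matrix.trace_smul, smul_smul, smul_eq_mul,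
    Matrix.sum_apply, Matrix.smul_apply]
  simp only [Matrix.trace, Matrix.diag_apply, Matrix.mul_apply]
  have (s : PauliString V) : (((Real.sqrt 2 : ℝ) : ℂ)⁻¹ ^ Fintype.card V *
      ∑ x, ∑ y, M x y * s.op y x) * ((Real.sqrt 2 : ℝ) : ℂ)⁻¹ ^ Fintype.card V * s.op c d =
      ∑ x, ∑ y, (1 / 2 ^ Fintype.card V : ℂ) * M x y * (s.op y x * s.op c d) := by
    rw [← inv_sqrt_two_pow_mul_self]
    simp only [Finset.sum_mul, Finset.mul_sum]
    exact Finset.sum_congr rfl fun _ _ => Finset.sum_congr rfl fun _ _ => by ring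
  rw [Finset.sum_congr rfl fun s _ => this s, Finset.sum_comm]
  simp_rw [mul_assoc]
  rw [Finset.sum_congr rfl fun x _ => Finset.sum_comm]
  simp only [← Finset.mul_sum, key]
  rw [Finset.sum_eq_single c, Finset.sum_eq_single d]
  · simp; field_simp
  · rintro y - hy; simp [hy]
  · simp
  · rintro x - hx
    simp [hx]
  · simp

end PauliAlgebra

/-! ### Heisenberg action of a single gate and of a split gate -/

section Gate

variable {V : Type*} [Fintype V] [DecidableEq V]

/-- Functional calculus for an involution: `φ` sends `(z, w)` to `z (1 + P) / 2 + w (1 - P) / 2`, a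
continuous ring homomorphism, so it commutes with `exp`; and `c • P = φ (c, -c)`. -/
theorem exp_smul_of_mul_self_eq_one {n : Type*} [Fintype n] [DecidableEq n]
    (P : Matrix n n ℂ) (hP : P * P = 1) (c : ℂ) :
    NormedSpace.exp (c • P) = Complex.cosh c • (1 : Matrix n n ℂ) + Complex.sinh c • P := by
  let φ : ℂ × ℂ →+* Matrix n n ℂ :=
    { toFun z := ((z.1 + z.2) / 2) • (1 : Matrix n n ℂ) + ((z.1 - z.2) / 2) • P
      map_one' := by simp
      map_zero' := by simp
      map_add' z w := by
        simp only [Prod.fst_add, Prod.snd_add]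
        module
      map_mul' z w := by
        simp only [Prod.fst_mul, Prod.snd_mul, mul_add, add_mul, smul_mul_smul_comm, hP, mul_one,
          one_mul]
        module }
  have hφ : Continuous φ := by
    change Continuous fun z : ℂ × ℂ =>
      ((z.1 + z.2) / 2) • (1 : Matrix n n ℂ) + ((z.1 - z.2) / 2) • P
    fun_prop
  let _ : NormedRing (Matrix n n ℂ) := Matrix.linftyOpNormedRing
  let _ : NormedAlgebra ℂ (Matrix n n ℂ) := Matrix.linftyOpNormedAlgebra
  have h := NormedSpace.map_exp φ hφ ((c, -c) : ℂ × ℂ)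
  have h1 : φ (c, -c) = c • P := by
    change ((c + -c) / 2) • (1 : Matrix n n ℂ) + ((c - -c) / 2) • P = _
    module
  rw [h1] at h
  refine h.symm.trans ?_
  change (((NormedSpace.exp ((c, -c) : ℂ × ℂ)).1 + (NormedSpace.exp ((c, -c) : ℂ × ℂ)).2) / 2) •
    (1 : Matrix n n ℂ) +
    (((NormedSpace.exp ((c, -c) : ℂ × ℂ)).1 - (NormedSpace.exp ((c, -c) : ℂ × ℂ)).2) / 2) • P = _
  rw [Prod.fst_exp, Prod.snd_exp, ← Complex.exp_eq_exp_ℂ]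
  rfl

theorem gateOp_eq (t : ℝ) (a b : V) :
    gateOp t a b = ((Real.cos (t / 2) : ℝ) : ℂ) • (1 : Op V) -
      (Complex.I * ((Real.sin (t / 2) : ℝ) : ℂ)) • (twoSite Pauli.Z a Pauli.Y b).op := by
  rw [gateOp, exp_smul_of_mul_self_eq_one _ (PauliString.op_mul_self _)]
  have : -(Complex.I * (t : ℂ) / 2) = -(((t / 2 : ℝ) : ℂ) * Complex.I) := by push_cast; ring
  rw [this, Complex.cosh_neg, Complex.sinh_neg, Complex.cosh_mul_I, Complex.sinh_mul_I, neg_smul,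
    ← sub_eq_add_neg, mul_comm Complex.I, Complex.ofReal_cos, Complex.ofReal_sin]

theorem gateOp_conjTranspose (t : ℝ) (a b : V) :
    (gateOp t a b)ᴴ = ((Real.cos (t / 2) : ℝ) : ℂ) • (1 : Op V) +
      (Complex.I * ((Real.sin (t / 2) : ℝ) : ℂ)) • (twoSite Pauli.Z a Pauli.Y b).op := by
  rw [gateOp_eq]
  simp only [Matrix.conjTranspose_sub, Matrix.conjTranspose_smul, Matrix.conjTranspose_one,
    PauliString.op_conjTranspose, star_mul', RCLike.star_def, Complex.conj_I, Complex.conj_ofReal]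
  module

/-- Heisenberg evolution of an operator that commutes with the generator of the gate. -/
theorem gateOp_conj_of_commute (t : ℝ) (a b : V) (M : Op V)
    (h : (twoSite Pauli.Z a Pauli.Y b).op * M = M * (twoSite Pauli.Z a Pauli.Y b).op) :
    (gateOp t a b)ᴴ * M * gateOp t a b = M := by
  have hP := PauliString.op_mul_self (twoSite Pauli.Z a Pauli.Y b)
  rw [gateOp_conjTranspose, gateOp_eq]
  generalize (twoSite Pauli.Z a Pauli.Y b).op = P at h hP
  have h3 : P * M * P = M := by rw [h, mul_assoc, hP, mul_one]
  simp only [add_mul, mul_sub, smul_mul_assoc, mul_smul_comm, one_mul, mul_one, h3]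
  rw [h]
  have hsq : ((Real.cos (t / 2) : ℝ) : ℂ) ^ 2 + ((Real.sin (t / 2) : ℝ) : ℂ) ^ 2 = 1 := by
    norm_cast; exact Real.cos_sq_add_sin_sq _
  generalize ((Real.cos (t / 2) : ℝ) : ℂ) = c at *
  generalize ((Real.sin (t / 2) : ℝ) : ℂ) = s at *
  match_scalars
  · linear_combination hsq - s ^ 2 * Complex.I_sq
  · ring

/-- Heisenberg evolution of an operator that anticommutes with the generator of the gate. -/
theorem gateOp_conj_of_anticommute (t : ℝ) (a b : V) (M : Op V)
    (h : (twoSite Pauli.Z a Pauli.Y b).op * M = -(M * (twoSite Pauli.Z a Pauli.Y b).op)) :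
    (gateOp t a b)ᴴ * M * gateOp t a b = ((Real.cos t : ℝ) : ℂ) • M +
      (Complex.I * ((Real.sin t : ℝ) : ℂ)) • ((twoSite Pauli.Z a Pauli.Y b).op * M) := by
  have hP := PauliString.op_mul_self (twoSite Pauli.Z a Pauli.Y b)
  rw [gateOp_conjTranspose, gateOp_eq]
  generalize (twoSite Pauli.Z a Pauli.Y b).op = P at h hP
  have h3 : P * M * P = -M := by rw [h, neg_mul, mul_assoc, hP, mul_one]
  have h4 : M * P = -(P * M) := by rw [h, neg_neg]
  simp only [add_mul, mul_sub, smul_mul_assoc, mul_smul_comm, one_mul, mul_one, h3]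
  rw [h4]
  have hc : ((Real.cos t : ℝ) : ℂ) =
      ((Real.cos (t / 2) : ℝ) : ℂ) ^ 2 - ((Real.sin (t / 2) : ℝ) : ℂ) ^ 2 := by
    norm_cast; rw [← Real.cos_two_mul', mul_div_cancel₀ _ (two_ne_zero)]
  have hs : ((Real.sin t : ℝ) : ℂ) =
      2 * ((Real.sin (t / 2) : ℝ) : ℂ) * ((Real.cos (t / 2) : ℝ) : ℂ) := by
    norm_cast; rw [← Real.sin_two_mul, mul_div_cancel₀ _ (two_ne_zero)]
  rw [hc, hs]
  generalize ((Real.cos (t / 2) : ℝ) : ℂ) = c at *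
  generalize ((Real.sin (t / 2) : ℝ) : ℂ) = s at *
  match_scalars
  · linear_combination s ^ 2 * Complex.I_sq
  · ring

theorem sgn_twoSite {a b : V} (hab : a ≠ b) (P Q : Pauli) (s : PauliString V) :
    PauliString.sgn (twoSite P a Q b) s = P.sgn (s a) * Q.sgn (s b) := by
  rw [PauliString.sgn, ← Finset.mul_prod_erase _ _ (Finset.mem_univ a),
    ← Finset.mul_prod_erase _ _ (Finset.mem_erase.2 ⟨hab.symm, Finset.mem_univ b⟩),
    Finset.prod_eq_one]
  · simp [twoSite, hab.symm]
  · intro v hv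
    simp only [Finset.mem_erase] at hv
    simp [twoSite, hv.1, hv.2.1, Pauli.sgn]

/-- The gate factor `tr(U† s U s')`. -/
noncomputable def gateFactor (t : ℝ) (a b : V) (s s' : PauliString V) : ℂ :=
  ((gateOp t a b)ᴴ * s.normOp * gateOp t a b * s'.normOp).trace

theorem gateFactor_of_sgn_one {t : ℝ} {a b : V} {s s' : PauliString V}
    (h : (twoSite Pauli.Z a Pauli.Y b).sgn s = 1) :
    gateFactor t a b s s' = if s = s' then 1 else 0 := by
  rw [gateFactor, gateOp_conj_of_commute, PauliString.trace_normOp_mul_normOp]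
  rw [PauliString.normOp, mul_smul_comm, smul_mul_assoc, PauliString.op_mul_comm, h, one_smul]

theorem gateFactor_of_sgn_neg_one {t : ℝ} {a b : V} {s s' : PauliString V}
    (h : (twoSite Pauli.Z a Pauli.Y b).sgn s = -1) :
    gateFactor t a b s s' = (if s = s' then ((Real.cos t : ℝ) : ℂ) else 0) +
      Complex.I * ((Real.sin t : ℝ) : ℂ) *
        ((twoSite Pauli.Z a Pauli.Y b).op * s.normOp * s'.normOp).trace := by
  rw [gateFactor, gateOp_conj_of_anticommute, add_mul, smul_mul_assoc, smul_mul_assoc,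
    Matrix.trace_add, Matrix.trace_smul, Matrix.trace_smul, PauliString.trace_normOp_mul_normOp]
  · simp
  · rw [PauliString.normOp, mul_smul_comm, smul_mul_assoc, PauliString.op_mul_comm, h]
    simp

omit [Fintype V] in
-- The letter `Z` always changes the letter at `a`. Hence the sine term contributes nothing to a
-- factor in which the string stays put.
theorem mulString_twoSite_ne {a b : V} (s : PauliString V) :
    (twoSite Pauli.Z a Pauli.Y b).mulString s ≠ s := by
  intro h
  have := congrFun h a
  simp only [PauliString.mulString, twoSite, if_true] at this
  generalize s a = P at this
  cases P <;> simp [Pauli.mulLetter] at this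

theorem gateFactor_self (t : ℝ) (a b : V) (s : PauliString V) :
    gateFactor t a b s s =
      if (twoSite Pauli.Z a Pauli.Y b).sgn s = 1 then 1 else ((Real.cos t : ℝ) : ℂ) := by
  rcases PauliString.sgn_eq (twoSite Pauli.Z a Pauli.Y b) s with h | h
  · rw [gateFactor_of_sgn_one h]; simp [h]
  · rw [gateFactor_of_sgn_neg_one h, h]
    have h0 := PauliString.norm_trace_op_mul_normOp_mul_normOp (twoSite Pauli.Z a Pauli.Y b) s s
    rw [if_neg (mulString_twoSite_ne s).symm, norm_eq_zero] at h0
    have : ¬ ((-1 : ℂ) = 1) := by norm_num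
    simp [h0, this]

theorem norm_gateFactor_of_ne_le {t : ℝ} {a b : V} {s s' : PauliString V} (h : s' ≠ s) :
    ‖gateFactor t a b s s'‖ ≤ |Real.sin t| := by
  rcases PauliString.sgn_eq (twoSite Pauli.Z a Pauli.Y b) s with h1 | h1
  · rw [gateFactor_of_sgn_one h1]; simp [h.symm]
  · rw [gateFactor_of_sgn_neg_one h1, if_neg h.symm, zero_add, norm_mul,
      PauliString.norm_trace_op_mul_normOp_mul_normOp, norm_mul, Complex.norm_I, one_mul,
      Complex.norm_real, Real.norm_eq_abs]
    split <;> simp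

theorem gateFactor_ne_zero {t : ℝ} {a b : V} {s s' : PauliString V} (h : s' ≠ s)
    (h0 : gateFactor t a b s s' ≠ 0) :
    (twoSite Pauli.Z a Pauli.Y b).sgn s = -1 ∧
      s' = (twoSite Pauli.Z a Pauli.Y b).mulString s := by
  rcases PauliString.sgn_eq (twoSite Pauli.Z a Pauli.Y b) s with h1 | h1
  · rw [gateFactor_of_sgn_one h1] at h0; simp [h.symm] at h0
  · refine ⟨h1, ?_⟩
    by_contra h2
    have h3 := PauliString.norm_trace_op_mul_normOp_mul_normOp (twoSite Pauli.Z a Pauli.Y b) s s'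
    rw [if_neg h2, norm_eq_zero] at h3
    rw [gateFactor_of_sgn_neg_one h1, h3] at h0
    simp [h.symm] at h0

theorem norm_gateFactor_self_le (t : ℝ) (a b : V) (s : PauliString V) :
    ‖gateFactor t a b s s‖ ≤ 1 := by
  rw [gateFactor_self]
  split
  · simp
  · rw [Complex.norm_real]; exact Real.abs_cos_le_one t

/-- The split factor differs from the gate factor only if both letters anticommute with those of
the generator, and then by `cos² t`. -/
theorem splitFactor_eq {t : ℝ} {a b : V} (hab : a ≠ b) (s : PauliString V) :
    splitFactor t a b s = gateFactor t a b s s *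
      if Pauli.sgn .Z (s a) = -1 ∧ Pauli.sgn .Y (s b) = -1 then ((Real.cos t : ℝ) : ℂ) ^ 2
      else 1 := by
  have hs : splitFactor t a b s =
      gateFactor t (Sum.inl a : V ⊕ Bool) (Sum.inr false) (Sum.elim s fun _ => Pauli.I)
        (Sum.elim s fun _ => Pauli.I) *
      gateFactor t (Sum.inr true : V ⊕ Bool) (Sum.inl b) (Sum.elim s fun _ => Pauli.I)
        (Sum.elim s fun _ => Pauli.I) := rfl
  rw [hs, gateFactor_self, gateFactor_self, gateFactor_self, sgn_twoSite (by simp),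
    sgn_twoSite (by simp), sgn_twoSite hab]
  have h1 : Pauli.sgn .Y .I = 1 := by simp [Pauli.sgn]
  have h2 : Pauli.sgn .Z .I = 1 := by simp [Pauli.sgn]
  simp only [Sum.elim_inl, Sum.elim_inr, h1, h2, mul_one, one_mul]
  have h3 : ¬ ((-1 : ℂ) = 1) := by norm_num
  have h4 : ¬ ((1 : ℂ) = -1) := by norm_num
  -- The auxiliary nodes carry `I`, so each split gate sees one letter only. If both letters
  -- anticommute, their signs cancel in the original gate (factor 1), while each split gate gives a
  -- cosine. In the other cases the two sides agree.
  rcases Pauli.sgn_eq .Z (s a) with h | h <;> rcases Pauli.sgn_eq .Y (s b) with h' | h' <;>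
    simp [h, h', h3, h4, sq]

end Gate

/-! ### Expansion of the expectation over Pauli paths -/

section PathExpansion

variable {V : Type*} [Fintype V] [DecidableEq V]

/-- Expand the tensor power of `X + I`, the all-ones matrix. The result is `2^N |+⟩⟨+|`, which is
where the sum over `v` comes from. -/
theorem sum_xString_op : ∑ v : Finset V, (xString v).op = Matrix.of fun _ _ => (1 : ℂ) := by
  ext a b
  simp only [Matrix.sum_apply, PauliString.op, Matrix.of_apply, xString]
  have h := Finset.prod_add (fun w : V => Pauli.X.mat (a w) (b w))
    (fun w => Pauli.I.mat (a w) (b w)) Finset.univ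
  have h1 : ∀ x y : Fin 2, Pauli.X.mat x y + Pauli.I.mat x y = 1 := by
    intro x y
    fin_cases x <;> fin_cases y <;> simp [Pauli.mat]
  simp only [h1, Finset.prod_const_one, Finset.powerset_univ] at h
  rw [h]
  refine Finset.sum_congr rfl fun v _ => ?_
  rw [← Finset.prod_mul_prod_compl v, Finset.compl_eq_univ_sdiff]
  congr 1
  · exact Finset.prod_congr rfl fun w hw => by rw [if_pos hw]
  · exact Finset.prod_congr rfl fun w hw => by rw [if_neg (Finset.mem_sdiff.1 hw).2]

theorem plusState_expectation (M : Op V) :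
    star (plusState V) ⬝ᵥ (M *ᵥ plusState V) =
      1 / 2 ^ Fintype.card V * ∑ v : Finset V, (M * (xString v).op).trace := by
  have h : ∑ v : Finset V, (M * (xString v).op).trace =
      (M * ∑ v : Finset V, (xString v).op).trace := by
    rw [Finset.mul_sum, Matrix.trace_sum]
  rw [h, sum_xString_op, ← inv_sqrt_two_pow_mul_self]
  simp only [dotProduct, Matrix.mulVec, plusState, Pi.star_apply, Matrix.trace, Matrix.diag_apply,
    Matrix.mul_apply, Matrix.of_apply, mul_one, Finset.mul_sum, star_pow, star_inv₀,
    RCLike.star_def, Complex.conj_ofReal]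
  exact Finset.sum_congr rfl fun _ _ => Finset.sum_congr rfl fun _ _ => by ring

/-- Induction that peels off the gate acting first, which is the last to conjugate: the operator it
produces from `s 0` is expanded in the orthonormal Pauli basis, and the new string is put in front
of the path. -/
theorem conj_eq_sum_paths (n : ℕ) (U : Fin n → Op V) (O : Op V) :
    ((List.ofFn U).reverse.prod)ᴴ * O * (List.ofFn U).reverse.prod =
      ∑ s : Fin (n + 1) → PauliString V,
        ((O * (s (Fin.last _)).normOp).trace *
          ∏ m : Fin n, ((U m)ᴴ * (s m.succ).normOp * U m * (s m.castSucc).normOp).trace) •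
            (s 0).normOp := by
  induction n with
  | zero =>
    rw [← (Equiv.funUnique (Fin 1) (PauliString V)).symm.sum_comp]
    simpa using (sum_trace_mul_normOp_smul O).symm
  | succ n ih =>
    rw [List.ofFn_succ, List.reverse_cons, List.prod_append, List.prod_singleton,
      Matrix.conjTranspose_mul]
    have h : (U 0)ᴴ * ((List.ofFn fun i => U i.succ).reverse.prod)ᴴ * O *
        ((List.ofFn fun i => U i.succ).reverse.prod * U 0) =
        (U 0)ᴴ * (((List.ofFn fun i => U i.succ).reverse.prod)ᴴ * O *
        ((List.ofFn fun i => U i.succ).reverse.prod)) * U 0 := by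
      simp only [mul_assoc]
    rw [h, ih, ← (Fin.consEquiv fun _ : Fin (n + 2) => PauliString V).sum_comp,
      Fintype.sum_prod_type_right,
      Finset.mul_sum, Finset.sum_mul]
    refine Finset.sum_congr rfl fun s _ => ?_
    rw [mul_smul_comm, smul_mul_assoc,
      ← sum_trace_mul_normOp_smul ((U 0)ᴴ * (s 0).normOp * U 0), Finset.smul_sum]
    refine Finset.sum_congr rfl fun r _ => ?_
    rw [smul_smul, Fin.prod_univ_succ]
    congr 1
    simp only [Fin.consEquiv_apply, Fin.cons_zero, Fin.castSucc_zero, ← Fin.succ_last,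
      Fin.cons_succ, ← Fin.succ_castSucc]
    ring

variable {G : SimpleGraph V} {p : ℕ} (A : Ansatz G p)

/-- The expansion of the expectation over Pauli paths. -/
theorem Ansatz.expectation_eq_sum (θ : Fin p → ℝ) (i j : V) :
    A.expectation θ i j = 1 / 2 ^ Fintype.card V *
      ∑ v : Finset V, ∑ s : A.Path, A.contribution θ i j v s := by
  have h : A.expectation θ i j = star (plusState V) ⬝ᵥ
      (((A.circuit θ)ᴴ * (twoSite Pauli.Z i Pauli.Z j).op * A.circuit θ) *ᵥ plusState V) := by
    rw [Ansatz.expectation, Ansatz.state, Matrix.star_mulVec, ← Matrix.dotProduct_mulVec,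
      Matrix.mulVec_mulVec, Matrix.mulVec_mulVec, mul_assoc]
  rw [h, plusState_expectation, Ansatz.circuit, conj_eq_sum_paths]
  congr 1
  refine Finset.sum_congr rfl fun v _ => ?_
  rw [Finset.sum_mul, Matrix.trace_sum]
  refine Finset.sum_congr rfl fun s _ => ?_
  rw [smul_mul_assoc, Matrix.trace_smul, smul_eq_mul]
  rfl

end PathExpansion


/-! ### Multigraphs all of whose cuts are even -/

section Cuts

variable {α β : Type*} {H : Graph α β}

/-- A walk that leaves a set uses an edge leaving it. -/
theorem exists_isLink_of_reflTransGen {S : Set α} {x y : α}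
    (h : Relation.ReflTransGen H.Adj x y) (hx : x ∈ S) (hy : y ∉ S) :
    ∃ e u w, H.IsLink e u w ∧ u ∈ S ∧ w ∉ S := by
  induction h with
  | refl => exact absurd hx hy
  | @tail b c _ hbc ih =>
    by_cases hb : b ∈ S
    · obtain ⟨e, he⟩ := hbc
      exact ⟨e, b, c, he, hb, hy⟩
    · exact ih hb

variable [Fintype β]

open Classical in
/-- The edges of a multigraph that join a set of nodes to its complement. -/
noncomputable def edgeCut (H : Graph α β) (S : Set α) : Finset β :=
  Finset.univ.filter fun e => ∃ u w, H.IsLink e u w ∧ u ∈ S ∧ w ∉ S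

theorem mem_edgeCut {S : Set α} {e : β} :
    e ∈ edgeCut H S ↔ ∃ u w, H.IsLink e u w ∧ u ∈ S ∧ w ∉ S := by
  simp [edgeCut]

theorem two_le_card_edgeCut (hH : GraphConnected H) {S : Set α} (hS : Even (edgeCut H S).card)
    {x y : α} (hx : x ∈ H.vertexSet) (hy : y ∈ H.vertexSet) (hxS : x ∈ S) (hyS : y ∉ S) :
    2 ≤ (edgeCut H S).card := by
  obtain ⟨e, he⟩ := exists_isLink_of_reflTransGen (hH.2 x hx y hy) hxS hyS
  have : 0 < (edgeCut H S).card := Finset.card_pos.2 ⟨e, mem_edgeCut.2 he⟩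
  obtain ⟨n, hn⟩ := hS
  omega

/-- If deleting `e` separated `x` from `y`, the cut around the component of `x` would be nonempty
and even, so it would contain an edge other than `e`, which enlarges the component. -/
theorem twoEdgeConnected_of_even_edgeCut (hH : GraphConnected H)
    (heven : ∀ S, Even (edgeCut H S).card) : TwoEdgeConnected H := by
  refine ⟨hH, fun e _ => ⟨hH.1, fun x hx y hy => ?_⟩⟩
  by_contra hxy
  have h2 := two_le_card_edgeCut hH
    (heven {z | Relation.ReflTransGen (H.deleteEdges {e}).Adj x z}) hx hy .refl hxy
  obtain ⟨f, hf, hfe⟩ := Finset.exists_mem_ne (Nat.lt_of_succ_le h2) e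
  obtain ⟨u, w, hl, hu, hw⟩ := mem_edgeCut.1 hf
  exact hw (Relation.ReflTransGen.tail hu ⟨f, by simpa using ⟨hl, hfe⟩⟩)

/-- If all cuts are even, a node at level `k` of a function that changes by at most one along every
edge forces two edges between any two consecutive levels below `k`. -/
theorem exists_two_mul_le_card_of_level (hH : GraphConnected H)
    (heven : ∀ S, Even (edgeCut H S).card) (d : α → ℕ)
    (hd : ∀ e x y, H.IsLink e x y → d y ≤ d x + 1) {x y : α} {k : ℕ}
    (hx : x ∈ H.vertexSet) (hxd : d x = 0) (hy : y ∈ H.vertexSet) (hyd : k ≤ d y) :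
    ∃ F : Finset β, 2 * k ≤ F.card ∧ ∀ e ∈ F, ∃ u w, H.IsLink e u w ∧ d u < k ∧ d u < d w := by
  classical
  have hcut {r : ℕ} {e : β} (he : e ∈ edgeCut H {z | d z ≤ r}) :
      ∃ u w, H.IsLink e u w ∧ d u = r ∧ d w = r + 1 := by
    obtain ⟨u, w, hl, hu, hw⟩ := mem_edgeCut.1 he
    have := hd e u w hl
    simp only [Set.mem_ofPred_eq] at hu hw
    exact ⟨u, w, hl, by omega, by omega⟩
  refine ⟨(Finset.range k).biUnion fun r => edgeCut H {z | d z ≤ r}, ?_, ?_⟩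
  · rw [Finset.card_biUnion]
    · have := Finset.card_nsmul_le_sum (Finset.range k)
        (fun r => (edgeCut H {z | d z ≤ r}).card) 2 fun r hr => by
          refine two_le_card_edgeCut hH (heven _) hx hy (by simp [hxd]) ?_
          have := Finset.mem_range.1 hr
          simp only [Set.mem_ofPred_eq]
          omega
      simpa [mul_comm] using this
    -- An edge of the cut at `r` joins levels `r` and `r + 1` exactly, so different cuts share no
    -- edge.
    · intro r _ r' _ hrr
      refine Finset.disjoint_left.2 fun e he he' => hrr ?_
      obtain ⟨u, w, hl, hu, hw⟩ := hcut he
      obtain ⟨u', w', hl', hu', hw'⟩ := hcut he'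
      rcases hl.eq_and_eq_or_eq_and_eq hl' with ⟨rfl, rfl⟩ | ⟨rfl, rfl⟩ <;> omega
  · intro e he
    obtain ⟨r, hr, he⟩ := Finset.mem_biUnion.1 he
    obtain ⟨u, w, hl, hu, hw⟩ := hcut he
    have := Finset.mem_range.1 hr
    exact ⟨u, w, hl, by omega, by omega⟩

end Cuts

/-! ### The parity of the letters `Y` and `Z` -/

section Weight

variable {V : Type*}

/-- The parity of `Y` and `Z` in a Pauli letter. -/
def Pauli.zBit : Pauli → ZMod 2
  | .I => 0
  | .X => 0
  | .Y => 1
  | .Z => 1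

/-- A homomorphism from Pauli letters modulo phase that kills `X`: it vanishes on the final strings
and equals 1 on every letter of a generator or of `Z_i Z_j`. -/
theorem Pauli.zBit_mulLetter (P Q : Pauli) : (P.mulLetter Q).zBit = P.zBit + Q.zBit := by
  cases P <;> cases Q <;> decide

open Classical in
/-- The parity of the number of letters `Y` and `Z` of a Pauli string on a set of nodes. -/
noncomputable def PauliString.zWeight [Fintype V] (S : Set V) (s : PauliString V) : ZMod 2 :=
  ∑ x, if x ∈ S then (s x).zBit else 0

theorem PauliString.zWeight_mulString [Fintype V] (S : Set V) (s t : PauliString V) :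
    (s.mulString t).zWeight S = s.zWeight S + t.zWeight S := by
  simp only [PauliString.zWeight, ← Finset.sum_add_distrib]
  refine Finset.sum_congr rfl fun x _ => ?_
  split
  · exact Pauli.zBit_mulLetter _ _
  · simp

open Classical in
theorem zWeight_twoSite [Fintype V] [DecidableEq V] (S : Set V) {a b : V} (hab : a ≠ b)
    {P Q : Pauli} (hP : P.zBit = 1) (hQ : Q.zBit = 1) :
    PauliString.zWeight S (twoSite P a Q b) = (if a ∈ S then 1 else 0) + if b ∈ S then 1 else 0 := by
  have h (x : V) : (if x ∈ S then (twoSite P a Q b x).zBit else 0) =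
      (if a = x then (if a ∈ S then 1 else 0) else 0) +
        if b = x then (if b ∈ S then 1 else 0) else 0 := by
    by_cases hxa : x = a
    · subst hxa; simp [twoSite, hP, hab.symm]
    · by_cases hxb : x = b
      · subst hxb; simp [twoSite, hQ, hab, hab.symm]
      · simp [twoSite, hxa, hxb, Ne.symm hxa, Ne.symm hxb, Pauli.zBit]
  rw [PauliString.zWeight, Finset.sum_congr rfl fun x _ => h x, Finset.sum_add_distrib,
    Finset.sum_ite_eq, Finset.sum_ite_eq]
  simp

theorem sum_castSucc_add_succ_eq_zmod_two {n : ℕ} (f : Fin (n + 1) → ZMod 2) :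
    ∑ m : Fin n, (f m.castSucc + f m.succ) = f 0 + f (Fin.last n) := by
  have h1 := Fin.sum_univ_succ f
  have h2 := Fin.sum_univ_castSucc f
  rw [h1] at h2
  rw [Finset.sum_add_distrib]
  have h3 := CharTwo.add_self_eq_zero (f (Fin.last n))
  have h4 := CharTwo.add_self_eq_zero (∑ m : Fin n, f m.succ)
  linear_combination -h2 + h4 - h3

end Weight

/-! ### Allowed paths and their relevant-gate graphs -/

namespace Ansatz

variable {V : Type*} [Fintype V] [DecidableEq V] {G : SimpleGraph V} {p : ℕ} (A : Ansatz G p)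

omit [Fintype V] [DecidableEq V] in
theorem adj_gate (m : Fin A.numGates) : G.Adj (A.gateZ m) (A.gateY m) := (A.gates.get m).2.adj

/-- The generator of gate number `m`. -/
def generator (m : Fin A.numGates) : PauliString V :=
  twoSite Pauli.Z (A.gateZ m) Pauli.Y (A.gateY m)

/-- The Pauli paths that the circuit allows: they start at `Z_i Z_j`, every relevant gate
anticommutes with the string that it transforms, and they end at a string of letters `I`, `X`. -/
structure IsAllowed (i j : V) (s : A.Path) : Prop where
  last : s (Fin.last _) = twoSite Pauli.Z i Pauli.Z j
  step : ∀ m, A.Relevant s m → (A.generator m).sgn (s m.succ) = -1 ∧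
    s m.castSucc = (A.generator m).mulString (s m.succ)
  zero : ∃ v : Finset V, s 0 = xString v

variable {A} {i j : V} {s : A.Path}

omit [Fintype V] [DecidableEq V] in
theorem isLink_none_iff {x y : V} :
    (A.relevantGraph i j s).IsLink none x y ↔ s(x, y) = s(i, j) := Iff.rfl

omit [Fintype V] [DecidableEq V] in
theorem isLink_some_iff {m : Fin A.numGates} {x y : V} :
    (A.relevantGraph i j s).IsLink (some m) x y ↔
      A.Relevant s m ∧ s(x, y) = s(A.gateZ m, A.gateY m) := Iff.rfl

/-- Modulo 2, edge `some m` lies in the cut iff gate `m` changes the parity on `S`, and `none` lies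
in it iff `Z_i Z_j` has odd parity there. The changes telescope to the parity of `s (Fin.last _)`,
since `s 0` has parity 0, and the two contributions cancel. -/
theorem IsAllowed.even_edgeCut (hs : A.IsAllowed i j s) (hij : i ≠ j) (S : Set V) :
    Even (edgeCut (A.relevantGraph i j s) S).card := by
  classical
  rw [← ZMod.natCast_eq_zero_iff_even]
  have hpair (a b : V) : (if ∃ u w, s(u, w) = s(a, b) ∧ u ∈ S ∧ w ∉ S then (1 : ZMod 2) else 0) =
      (if a ∈ S then 1 else 0) + if b ∈ S then 1 else 0 := by
    have h : (∃ u w, s(u, w) = s(a, b) ∧ u ∈ S ∧ w ∉ S) ↔ (a ∈ S ∧ b ∉ S) ∨ (b ∈ S ∧ a ∉ S) := by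
      constructor
      · rintro ⟨u, w, h, hu, hw⟩
        rcases Sym2.eq_iff.1 h with ⟨rfl, rfl⟩ | ⟨rfl, rfl⟩
        · exact Or.inl ⟨hu, hw⟩
        · exact Or.inr ⟨hu, hw⟩
      · rintro (h | h)
        · exact ⟨a, b, rfl, h⟩
        · exact ⟨b, a, Sym2.eq_swap, h⟩
    simp only [h]
    by_cases ha : a ∈ S <;> by_cases hb : b ∈ S <;> simp [ha, hb]
    decide
  have hm (m : Fin A.numGates) :
      (if some m ∈ edgeCut (A.relevantGraph i j s) S then (1 : ZMod 2) else 0) =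
        (s m.castSucc).zWeight S + (s m.succ).zWeight S := by
    simp only [mem_edgeCut, isLink_some_iff]
    by_cases hrel : A.Relevant s m
    · rw [(hs.step m hrel).2, PauliString.zWeight_mulString, add_assoc, CharTwo.add_self_eq_zero,
        add_zero, generator, zWeight_twoSite S (A.adj_gate m).ne (P := .Z) (Q := .Y) rfl rfl, ← hpair]
      simp [hrel]
    · have : s m.castSucc = s m.succ := by
        by_contra h
        exact hrel fun h' => h h'.symm
      rw [this, CharTwo.add_self_eq_zero]
      simp [hrel]
  have h0 : (s 0).zWeight S = 0 := by
    obtain ⟨v, hv⟩ := hs.zero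
    rw [hv, PauliString.zWeight]
    refine Finset.sum_eq_zero fun x _ => ?_
    by_cases hx : x ∈ v <;> simp [xString, hx, Pauli.zBit]
  have hnone : (if none ∈ edgeCut (A.relevantGraph i j s) S then (1 : ZMod 2) else 0) =
      (s (Fin.last _)).zWeight S := by
    rw [hs.last, zWeight_twoSite S hij (P := .Z) (Q := .Z) rfl rfl, ← hpair]
    simp only [mem_edgeCut, isLink_none_iff]
  have hcard : ((edgeCut (A.relevantGraph i j s) S).card : ZMod 2) =
      ∑ e, if e ∈ edgeCut (A.relevantGraph i j s) S then (1 : ZMod 2) else 0 := by simp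
  rw [hcard, Fintype.sum_option, hnone, Finset.sum_congr rfl fun m _ => hm m,
    sum_castSucc_add_succ_eq_zmod_two (fun m => (s m).zWeight S), h0, zero_add,
    CharTwo.add_self_eq_zero]

omit [Fintype V] [DecidableEq V] in
theorem reflTransGen_relevantGraph_symm {x y : V}
    (h : Relation.ReflTransGen (A.relevantGraph i j s).Adj x y) :
    Relation.ReflTransGen (A.relevantGraph i j s).Adj y x := by
  induction h with
  | refl => exact .refl
  | tail _ h ih => exact Relation.ReflTransGen.head h.symm ih

theorem ne_I_of_sgn_eq_neg_one {P Q : Pauli} (h : P.sgn Q = -1) : Q ≠ .I := by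
  rintro rfl
  have : ¬ ((1 : ℂ) = -1) := by norm_num
  simp [Pauli.sgn, this] at h

/-- A generator anticommutes with a string only if one of its two letters does, so the string is
nontrivial at an end of the gate; the gate's own edge then reaches the other end. -/
theorem IsAllowed.reachable_gate (hs : A.IsAllowed i j s) {m : Fin A.numGates}
    (hm : A.Relevant s m)
    (h : ∀ x, s m.succ x ≠ .I → Relation.ReflTransGen (A.relevantGraph i j s).Adj i x) :
    Relation.ReflTransGen (A.relevantGraph i j s).Adj i (A.gateZ m) ∧
      Relation.ReflTransGen (A.relevantGraph i j s).Adj i (A.gateY m) := by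
  have hadj : (A.relevantGraph i j s).Adj (A.gateZ m) (A.gateY m) := ⟨some m, hm, rfl⟩
  have hsgn := (hs.step m hm).1
  rw [generator, sgn_twoSite (A.adj_gate m).ne] at hsgn
  rcases Pauli.sgn_eq .Z (s m.succ (A.gateZ m)) with h1 | h1
  · rw [h1, one_mul] at hsgn
    have := h _ (ne_I_of_sgn_eq_neg_one hsgn)
    exact ⟨this.tail hadj.symm, this⟩
  · have := h _ (ne_I_of_sgn_eq_neg_one h1)
    exact ⟨this, this.tail hadj⟩

/-- Every node that is ever in the support of an allowed path can be reached from `i`. -/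
theorem IsAllowed.reachable_of_ne_I (hs : A.IsAllowed i j s) (m : Fin (A.numGates + 1)) :
    ∀ x, s m x ≠ .I → Relation.ReflTransGen (A.relevantGraph i j s).Adj i x := by
  -- Induction in Heisenberg order, from the observable at the last index down to index 0.
  induction m using Fin.reverseInduction with
  | last =>
    intro x hx
    rw [hs.last, twoSite] at hx
    by_cases hxi : x = i
    · rw [hxi]
    · by_cases hxj : x = j
      · rw [hxj]; exact .single ⟨none, rfl⟩
      · simp [hxi, hxj] at hx
  | cast m ih =>
    intro x hx
    by_cases hm : A.Relevant s m
    · have hg := hs.reachable_gate hm ih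
      rw [(hs.step m hm).2] at hx
      by_cases hxa : x = A.gateZ m
      · rw [hxa]; exact hg.1
      · by_cases hxb : x = A.gateY m
        · rw [hxb]; exact hg.2
        · refine ih x ?_
          simpa [PauliString.mulString, generator, twoSite, hxa, hxb, Pauli.mulLetter] using hx
    · refine ih x ?_
      have : s m.castSucc = s m.succ := by
        by_contra h
        exact hm fun h' => h h'.symm
      rwa [← this]

theorem IsAllowed.graphConnected (hs : A.IsAllowed i j s) :
    GraphConnected (A.relevantGraph i j s) := by
  have key (x : V) (hx : x ∈ (A.relevantGraph i j s).vertexSet) :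
      Relation.ReflTransGen (A.relevantGraph i j s).Adj i x := by
    rcases hx with rfl | rfl | ⟨m, hm, rfl | rfl⟩
    · exact .refl
    · exact .single ⟨none, rfl⟩
    · exact (hs.reachable_gate hm (hs.reachable_of_ne_I _)).1
    · exact (hs.reachable_gate hm (hs.reachable_of_ne_I _)).2
  exact ⟨⟨i, Or.inl rfl⟩, fun x hx y hy =>
    (reflTransGen_relevantGraph_symm (key x hx)).trans (key y hy)⟩

theorem IsAllowed.twoEdgeConnected (hs : A.IsAllowed i j s) (hij : i ≠ j) :
    TwoEdgeConnected (A.relevantGraph i j s) :=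
  twoEdgeConnected_of_even_edgeCut hs.graphConnected (hs.even_edgeCut hij)

theorem IsAllowed.mem_vertexSet_of_ne_I (hs : A.IsAllowed i j s) {m : Fin (A.numGates + 1)} {x : V}
    (hx : s m x ≠ .I) : x ∈ (A.relevantGraph i j s).vertexSet := by
  rcases Relation.ReflTransGen.cases_tail (hs.reachable_of_ne_I m x hx) with rfl | ⟨y, -, hy⟩
  · exact Or.inl rfl
  · exact hy.right_mem

/-! ### Counting relevant gates by distance to the edge `{i, j}` -/

/-- The distance of a node to the edge `{i, j}`. -/
noncomputable def edgeDist (G : SimpleGraph V) (i j x : V) : ℕ := min (G.dist i x) (G.dist j x)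

omit [Fintype V] [DecidableEq V] in
theorem edgeDist_le_add_one (hG : G.Connected) {x y : V} (h : G.Adj x y) :
    edgeDist G i j y ≤ edgeDist G i j x + 1 := by
  have h1 := hG.dist_triangle (u := i) (v := x) (w := y)
  have h2 := hG.dist_triangle (u := j) (v := x) (w := y)
  rw [SimpleGraph.dist_eq_one_iff_adj.2 h] at h1 h2
  simp only [edgeDist]
  omega

omit [Fintype V] in
-- If `x` were closer than `k`, a shortest walk to `x` followed by the edge would have length at
-- most `k` and make the edge local.
theorem le_edgeDist_of_not_kLocal_adj (hG : G.Connected) {k : ℕ} {x y : V} (hxy : G.Adj x y)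
    (h : ¬ (kLocal G i j k).Adj x y) : k ≤ edgeDist G i j x := by
  by_contra! hlt
  have key (c : V) (hc : c = i ∨ c = j) (hd : G.dist c x < k) : False := by
    obtain ⟨w, hw⟩ := hG.exists_walk_length_eq_dist c x
    refine h ⟨hxy, Or.inr ⟨c, hc, y, w.concat hxy, ?_, ?_⟩⟩
    · rw [SimpleGraph.Walk.length_concat]; omega
    · simp [SimpleGraph.Walk.edges_concat]
  rcases min_lt_iff.1 hlt with h1 | h1
  · exact key i (Or.inl rfl) h1
  · exact key j (Or.inr rfl) h1

omit [Fintype V] in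
theorem le_edgeDist_of_not_isLocalGate (hG : G.Connected) {k : ℕ} {m : Fin A.numGates}
    (h : ¬ A.IsLocalGate i j k m) :
    k ≤ edgeDist G i j (A.gateZ m) ∧ k ≤ edgeDist G i j (A.gateY m) :=
  ⟨le_edgeDist_of_not_kLocal_adj hG (A.adj_gate m) h,
    le_edgeDist_of_not_kLocal_adj hG (A.adj_gate m).symm fun h' => h h'.symm⟩

open Classical in
/-- The relevant gates of a path. -/
noncomputable def relevantGates (A : Ansatz G p) (s : A.Path) : Finset (Fin A.numGates) :=
  Finset.univ.filter (A.Relevant s)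

omit [Fintype V] [DecidableEq V] in
theorem mem_relevantGates {m : Fin A.numGates} : m ∈ A.relevantGates s ↔ A.Relevant s m := by
  simp [relevantGates]

/-- A node at distance at least `k` in the relevant-gate graph forces `2 k` relevant gates on edges
that are closer. -/
theorem IsAllowed.exists_relevant (hs : A.IsAllowed i j s) (hG : G.Connected) (hij : G.Adj i j)
    {k : ℕ} {x : V} (hx : x ∈ (A.relevantGraph i j s).vertexSet) (hk : k ≤ edgeDist G i j x) :
    ∃ F ⊆ A.relevantGates s, 2 * k ≤ F.card ∧ ∀ m ∈ F,
      edgeDist G i j (A.gateZ m) < k ∨ edgeDist G i j (A.gateY m) < k := by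
  classical
  have hi : edgeDist G i j i = 0 := by simp [edgeDist]
  have hj : edgeDist G i j j = 0 := by simp [edgeDist]
  obtain ⟨F, hF, hF'⟩ := exists_two_mul_le_card_of_level hs.graphConnected
    (hs.even_edgeCut hij.ne) (edgeDist G i j) (x := i) (y := x) (k := k) (fun e u w h => by
      refine edgeDist_le_add_one hG ?_
      rcases e with _ | m
      · rcases Sym2.eq_iff.1 (isLink_none_iff.1 h) with ⟨rfl, rfl⟩ | ⟨rfl, rfl⟩
        · exact hij
        · exact hij.symm
      · rcases Sym2.eq_iff.1 (isLink_some_iff.1 h).2 with ⟨rfl, rfl⟩ | ⟨rfl, rfl⟩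
        · exact A.adj_gate m
        · exact (A.adj_gate m).symm) (Or.inl rfl) hi hx hk
  -- Both ends of the additional edge have level 0, so it lies in none of the level cuts and all of
  -- `F` comes from actual gates.
  have hnone : none ∉ F := by
    intro h
    obtain ⟨u, w, hl, -, hlt⟩ := hF' _ h
    rcases Sym2.eq_iff.1 (isLink_none_iff.1 hl) with ⟨rfl, rfl⟩ | ⟨rfl, rfl⟩ <;> omega
  have hsome : F.eraseNone.map Function.Embedding.some = F := by
    rw [Finset.map_some_eraseNone, Finset.erase_eq_of_notMem hnone]
  refine ⟨F.eraseNone, fun m hm => ?_, ?_, fun m hm => ?_⟩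
  · obtain ⟨u, w, hl, -⟩ := hF' _ (Finset.mem_eraseNone.1 hm)
    exact mem_relevantGates.2 (isLink_some_iff.1 hl).1
  · rwa [← Finset.card_map Function.Embedding.some, hsome]
  · obtain ⟨u, w, hl, hlt, -⟩ := hF' _ (Finset.mem_eraseNone.1 hm)
    rcases Sym2.eq_iff.1 (isLink_some_iff.1 hl).2 with ⟨rfl, rfl⟩ | ⟨rfl, rfl⟩
    · exact Or.inl hlt
    · exact Or.inr hlt

theorem IsAllowed.two_mul_le_card_relevantGates (hs : A.IsAllowed i j s) (hG : G.Connected)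
    (hij : G.Adj i j) {k : ℕ} {m : Fin (A.numGates + 1)} {x : V} (hx : s m x ≠ .I)
    (hk : k ≤ edgeDist G i j x) : 2 * k ≤ (A.relevantGates s).card := by
  obtain ⟨F, hF, hc, -⟩ := hs.exists_relevant hG hij (hs.mem_vertexSet_of_ne_I hx) hk
  exact hc.trans (Finset.card_le_card hF)

/-- The truncating gate has both ends at level at least `k`, whereas each of the `2k` gates from the
level cuts has an end below `k`; so it is one more. -/
theorem IsAllowed.two_mul_add_one_le_card_relevantGates (hs : A.IsAllowed i j s)
    (hG : G.Connected) (hij : G.Adj i j) {k : ℕ} (ht : A.Truncated i j k s) :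
    2 * k + 1 ≤ (A.relevantGates s).card := by
  obtain ⟨m, hm, hloc⟩ := ht
  have hd := le_edgeDist_of_not_isLocalGate hG hloc
  obtain ⟨F, hF, hc, hF'⟩ := hs.exists_relevant hG hij
    (Or.inr (Or.inr ⟨m, hm, Or.inl rfl⟩)) hd.1
  have hmF : m ∉ F := fun h => by
    have := hF' m h
    omega
  have := Finset.card_lt_card (Finset.ssubset_iff_of_subset hF |>.2
    ⟨m, mem_relevantGates.2 hm, hmF⟩)
  omega

omit [Fintype V] [DecidableEq V] in
theorem ncard_edgeSet_relevantGraph :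
    (A.relevantGraph i j s).edgeSet.ncard = (A.relevantGates s).card + 1 := by
  have : (A.relevantGraph i j s).edgeSet = ((A.relevantGates s).insertNone : Set _) := by
    ext e
    rw [Graph.edge_mem_iff_exists_isLink]
    rcases e with _ | m
    · simpa using ⟨i, j, isLink_none_iff.2 rfl⟩
    · simp only [isLink_some_iff, SetLike.mem_coe, Finset.some_mem_insertNone, mem_relevantGates]
      exact ⟨fun ⟨_, _, h, _⟩ => h, fun h => ⟨_, _, h, rfl⟩⟩
  rw [this, Set.ncard_coe_finset, Finset.card_insertNone]

end Ansatz


/-! ### Error estimates -/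

theorem norm_prod_sub_one_le {ι : Type*} (F : Finset ι) (g : ι → ℂ) {ε : ℝ}
    (h1 : ∀ m ∈ F, ‖g m‖ ≤ 1) (h : ∀ m ∈ F, ‖g m - 1‖ ≤ ε) :
    ‖∏ m ∈ F, g m - 1‖ ≤ F.card * ε := by
  classical
  induction F using Finset.induction_on with
  | empty => simp
  | insert a F ha ih =>
    have h2 := ih (fun m hm => h1 m (Finset.mem_insert_of_mem hm))
      (fun m hm => h m (Finset.mem_insert_of_mem hm))
    have e : g a * ∏ m ∈ F, g m - 1 = g a * (∏ m ∈ F, g m - 1) + (g a - 1) := by ring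
    rw [Finset.prod_insert ha, Finset.card_insert_of_notMem ha, e]
    calc _ ≤ ‖g a‖ * ‖∏ m ∈ F, g m - 1‖ + ‖g a - 1‖ := by
          rw [← norm_mul]; exact norm_add_le _ _
      _ ≤ 1 * (F.card * ε) + ε := by
          gcongr
          · exact h1 a (Finset.mem_insert_self _ _)
          · exact h a (Finset.mem_insert_self _ _)
      _ = _ := by push_cast; ring

namespace Ansatz

variable {V : Type*} [Fintype V] [DecidableEq V] {G : SimpleGraph V} {p : ℕ} {A : Ansatz G p}
  {i j : V} {s : A.Path} {k : ℕ} {v : Finset V} {θ : Fin p → ℝ}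

omit [DecidableEq V] in
-- Each round uses every unordered pair of nodes at most once. This bound makes the final constant
-- independent of the edges of `G`.
theorem numGates_le (A : Ansatz G p) : A.numGates ≤ p * Fintype.card (Sym2 V) := by
  have h := List.sum_le_card_nsmul ((List.finRange p).map fun l => (A.round l).length)
    (Fintype.card (Sym2 V)) (by
      intro n hn
      obtain ⟨l, -, rfl⟩ := List.mem_map.1 hn
      rw [← List.length_map (f := SimpleGraph.Dart.edge)]
      exact (A.nodup l).length_le_card)
  simpa [numGates, gates, List.length_flatMap] using h

/-- The factor of gate number `m` in the contribution of a path. -/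
noncomputable def pathFactor (A : Ansatz G p) (θ : Fin p → ℝ) (s : A.Path) (m : Fin A.numGates) :
    ℂ :=
  gateFactor (θ (A.gateRound m)) (A.gateZ m) (A.gateY m) (s m.succ) (s m.castSucc)

theorem contribution_eq : A.contribution θ i j v s =
    ((twoSite Pauli.Z i Pauli.Z j).op * (s (Fin.last _)).normOp).trace *
      (∏ m, A.pathFactor θ s m) * ((xString v).op * (s 0).normOp).trace := by
  rw [Matrix.trace_mul_comm (xString v).op]
  rfl

open Classical in
theorem kLocalContribution_eq : A.kLocalContribution θ i j k v s =
    ((twoSite Pauli.Z i Pauli.Z j).op * (s (Fin.last _)).normOp).trace *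
      (∏ m, if A.IsChordGate i j k m then
        splitFactor (θ (A.gateRound m)) (A.gateZ m) (A.gateY m) (s m.succ)
        else A.pathFactor θ s m) * ((xString v).op * (s 0).normOp).trace := by
  rw [Matrix.trace_mul_comm (xString v).op]
  rfl

theorem isAllowed_of_ne_zero
    (h1 : ((twoSite Pauli.Z i Pauli.Z j).op * (s (Fin.last _)).normOp).trace ≠ 0)
    (h2 : ∀ m, A.Relevant s m → A.pathFactor θ s m ≠ 0)
    (h3 : ((xString v).op * (s 0).normOp).trace ≠ 0) : A.IsAllowed i j s where
  last := by
    by_contra h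
    exact h1 (PauliString.trace_op_mul_normOp_eq_zero h)
  step m hm := gateFactor_ne_zero (Ne.symm hm) (h2 m hm)
  zero := by
    refine ⟨v, ?_⟩
    by_contra h
    exact h3 (PauliString.trace_op_mul_normOp_eq_zero h)

theorem isAllowed_of_contribution_ne_zero (h : A.contribution θ i j v s ≠ 0) :
    A.IsAllowed i j s := by
  rw [contribution_eq] at h
  have h' := left_ne_zero_of_mul h
  exact isAllowed_of_ne_zero (left_ne_zero_of_mul h')
    (fun m _ => Finset.prod_ne_zero_iff.1 (right_ne_zero_of_mul h') m (Finset.mem_univ m))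
    (right_ne_zero_of_mul h)

theorem isAllowed_of_kLocalContribution_ne_zero (ht : ¬ A.Truncated i j k s)
    (h : A.kLocalContribution θ i j k v s ≠ 0) : A.IsAllowed i j s := by
  rw [kLocalContribution_eq] at h
  have h' := left_ne_zero_of_mul h
  refine isAllowed_of_ne_zero (θ := θ) (left_ne_zero_of_mul h') (fun m hm => ?_)
    (right_ne_zero_of_mul h)
  have hc : ¬ A.IsChordGate i j k m := fun hc => ht ⟨m, hm, hc.2.2⟩
  have := Finset.prod_ne_zero_iff.1 (right_ne_zero_of_mul h') m (Finset.mem_univ m)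
  rwa [if_neg hc] at this

omit [Fintype V] [DecidableEq V] in
theorem castSucc_eq_of_not_relevant {m : Fin A.numGates} (h : ¬ A.Relevant s m) :
    s m.castSucc = s m.succ := (not_not.1 h).symm

theorem norm_prod_pathFactor_le {r : ℝ} (hr : ∀ l, |Real.sin (θ l)| ≤ r) :
    ‖∏ m, A.pathFactor θ s m‖ ≤ r ^ (A.relevantGates s).card := by
  classical
  rw [norm_prod]
  calc ∏ m, ‖A.pathFactor θ s m‖ ≤ ∏ m, if m ∈ A.relevantGates s then r else 1 := by
        refine Finset.prod_le_prod (fun _ _ => norm_nonneg _) fun m _ => ?_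
        split
        · rename_i h
          exact (norm_gateFactor_of_ne_le (Ne.symm (mem_relevantGates.1 h))).trans (hr _)
        · rename_i h
          rw [mem_relevantGates] at h
          rw [pathFactor, castSucc_eq_of_not_relevant h]
          exact norm_gateFactor_self_le _ _ _ _
    _ = _ := by simp

/-- Both letters of the string at the gate anticommute with those of the generator. -/
def AnticommutesAtBothEnds (s : A.Path) (m : Fin A.numGates) : Prop :=
  Pauli.sgn .Z (s m.succ (A.gateZ m)) = -1 ∧ Pauli.sgn .Y (s m.succ (A.gateY m)) = -1

open Classical in
/-- The quotient of the factors of gate number `m` in the `k`-local and in the exact analysis. -/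
noncomputable def chordCorrection (θ : Fin p → ℝ) (i j : V) (k : ℕ) (s : A.Path)
    (m : Fin A.numGates) : ℂ :=
  if A.IsChordGate i j k m ∧ AnticommutesAtBothEnds s m then
    ((Real.cos (θ (A.gateRound m)) : ℝ) : ℂ) ^ 2 else 1

/-- A chord gate is not local, so it cannot be relevant for a path that is not truncated; there the
string stays put and `splitFactor_eq` applies. -/
theorem kLocalContribution_eq_of_not_truncated (ht : ¬ A.Truncated i j k s) :
    A.kLocalContribution θ i j k v s =
      ((twoSite Pauli.Z i Pauli.Z j).op * (s (Fin.last _)).normOp).trace *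
        ((∏ m, A.pathFactor θ s m) * ∏ m, chordCorrection θ i j k s m) *
        ((xString v).op * (s 0).normOp).trace := by
  classical
  rw [kLocalContribution_eq, ← Finset.prod_mul_distrib]
  congr 2
  refine Finset.prod_congr rfl fun m _ => ?_
  by_cases hc : A.IsChordGate i j k m
  · have hm : ¬ A.Relevant s m := fun hm => ht ⟨m, hm, hc.2.2⟩
    rw [if_pos hc, splitFactor_eq (A.adj_gate m).ne, pathFactor, castSucc_eq_of_not_relevant hm,
      chordCorrection]
    simp only [hc, true_and, AnticommutesAtBothEnds]
  · simp [chordCorrection, hc]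

omit [Fintype V] in
theorem norm_chordCorrection_le (m : Fin A.numGates) : ‖chordCorrection θ i j k s m‖ ≤ 1 := by
  rw [chordCorrection]
  split
  · rw [norm_pow, Complex.norm_real]
    exact pow_le_one₀ (norm_nonneg _) (Real.abs_cos_le_one _)
  · simp

omit [Fintype V] in
theorem norm_chordCorrection_sub_one_le {r : ℝ} (hr : ∀ l, |Real.sin (θ l)| ≤ r)
    (m : Fin A.numGates) : ‖chordCorrection θ i j k s m - 1‖ ≤ r ^ 2 := by
  rw [chordCorrection]
  split
  · have : ((Real.cos (θ (A.gateRound m)) : ℝ) : ℂ) ^ 2 - 1 =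
        ((-(Real.sin (θ (A.gateRound m))) ^ 2 : ℝ) : ℂ) := by
      rw [Real.sin_sq]; push_cast; ring
    rw [this, Complex.norm_real, norm_neg, norm_pow]
    exact pow_le_pow_left₀ (norm_nonneg _) (hr _) 2
  · simp [sq_nonneg]

theorem norm_trace_mul_mul_trace_le (z : ℂ) :
    ‖((twoSite Pauli.Z i Pauli.Z j).op * (s (Fin.last _)).normOp).trace * z *
      ((xString v).op * (s 0).normOp).trace‖ ≤ 4 ^ Fintype.card V * ‖z‖ := by
  rw [norm_mul, norm_mul]
  have h1 := PauliString.norm_trace_op_mul_normOp_le (twoSite Pauli.Z i Pauli.Z j)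
    (s (Fin.last _))
  have h2 := PauliString.norm_trace_op_mul_normOp_le (xString v) (s 0)
  calc _ ≤ 2 ^ Fintype.card V * ‖z‖ * 2 ^ Fintype.card V := by gcongr
    _ = (2 * 2) ^ Fintype.card V * ‖z‖ := by rw [mul_pow]; ring
    _ = _ := by norm_num

open Classical in
/-- The error of the `k`-local analysis for a single path. -/
theorem norm_sub_contribution_le (hG : G.Connected) (hij : G.Adj i j) {r : ℝ} (hr1 : r ≤ 1)
    (hr0 : 0 ≤ r) (hr : ∀ l, |Real.sin (θ l)| ≤ r) :
    ‖(if A.Truncated i j k s then 0 else A.kLocalContribution θ i j k v s) -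
      A.contribution θ i j v s‖ ≤
        4 ^ Fintype.card V * ((A.numGates + 1) * r ^ (2 * k + 1)) := by
  have hrk : 0 ≤ r ^ (2 * k + 1) := pow_nonneg hr0 _
  have hN : (0 : ℝ) ≤ A.numGates := Nat.cast_nonneg _
  have hprod := norm_prod_pathFactor_le (A := A) (s := s) hr
  by_cases hs : A.IsAllowed i j s
  · by_cases ht : A.Truncated i j k s
    · rw [if_pos ht, zero_sub, norm_neg, contribution_eq]
      refine (norm_trace_mul_mul_trace_le _).trans ?_
      gcongr
      calc _ ≤ r ^ (2 * k + 1) := hprod.trans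
            (pow_le_pow_of_le_one hr0 hr1 (hs.two_mul_add_one_le_card_relevantGates hG hij ht))
        _ ≤ _ := le_mul_of_one_le_left hrk (by linarith)
    · rw [if_neg ht, kLocalContribution_eq_of_not_truncated ht, contribution_eq, ← sub_mul,
        ← mul_sub, ← mul_sub_one]
      refine (norm_trace_mul_mul_trace_le _).trans ?_
      gcongr
      -- A nontrivial correction needs a chord whose ends, at level at least `k`, lie in the
      -- support, which already forces `2k` relevant gates. With the `r ^ 2` from the correction
      -- this is one power of `r` more than needed.
      by_cases hch : ∃ m, A.IsChordGate i j k m ∧ AnticommutesAtBothEnds s m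
      · obtain ⟨m, hm, ha, -⟩ := hch
        have hcard := hs.two_mul_le_card_relevantGates hG hij (ne_I_of_sgn_eq_neg_one ha)
          (le_edgeDist_of_not_isLocalGate hG hm.2.2).1
        have hc := norm_prod_sub_one_le Finset.univ (chordCorrection θ i j k s)
          (fun m _ => norm_chordCorrection_le m) (fun m _ => norm_chordCorrection_sub_one_le hr m)
        rw [Finset.card_univ, Fintype.card_fin] at hc
        rw [norm_mul]
        calc _ ≤ r ^ (2 * k) * (A.numGates * r ^ 2) := by
              gcongr
              exact hprod.trans (pow_le_pow_of_le_one hr0 hr1 hcard)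
          _ = A.numGates * r ^ (2 * k + 1) * r := by ring
          _ ≤ A.numGates * r ^ (2 * k + 1) * 1 := by gcongr
          _ ≤ _ := by linarith
      · have : ∏ m, chordCorrection θ i j k s m = 1 := by
          refine Finset.prod_eq_one fun m _ => ?_
          rw [chordCorrection, if_neg fun h => hch ⟨m, h⟩]
        rw [this, sub_self, mul_zero, norm_zero]
        positivity
  · have h1 : A.contribution θ i j v s = 0 := by
      by_contra h
      exact hs (isAllowed_of_contribution_ne_zero h)
    have h2 : (if A.Truncated i j k s then 0 else A.kLocalContribution θ i j k v s) = 0 := by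
      split
      · rfl
      · rename_i ht
        by_contra h
        exact hs (isAllowed_of_kLocalContribution_ne_zero ht h)
    rw [h1, h2, sub_zero, norm_zero]
    positivity

theorem norm_kLocalExpectation_sub_expectation_le (hG : G.Connected) (hij : G.Adj i j) {r : ℝ}
    (hr1 : r ≤ 1) (hr0 : 0 ≤ r) (hr : ∀ l, |Real.sin (θ l)| ≤ r) :
    ‖A.kLocalExpectation θ i j k - A.expectation θ i j‖ ≤
      2 ^ Fintype.card V * ((4 ^ Fintype.card V) ^ (A.numGates + 1) *
        (4 ^ Fintype.card V * ((A.numGates + 1) * r ^ (2 * k + 1)))) := by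
  classical
  have hB : (0 : ℝ) ≤ 4 ^ Fintype.card V * ((A.numGates + 1) * r ^ (2 * k + 1)) := by positivity
  have hcard : Fintype.card A.Path = (4 ^ Fintype.card V) ^ (A.numGates + 1) := by
    have : Fintype.card Pauli = 4 := rfl
    simp [this]
  rw [expectation_eq_sum, kLocalExpectation, ← mul_sub, ← Finset.sum_sub_distrib]
  simp only [← Finset.sum_sub_distrib]
  rw [norm_mul]
  have h1 : ‖(1 / 2 ^ Fintype.card V : ℂ)‖ ≤ 1 := by
    rw [norm_div, norm_one, norm_pow, Complex.norm_ofNat]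
    exact div_le_one_of_le₀ (one_le_pow₀ (by norm_num)) (by positivity)
  refine (mul_le_of_le_one_left (norm_nonneg _) h1).trans ?_
  refine (norm_sum_le_of_le _ fun v _ => norm_sum_le_of_le _ fun s _ =>
    norm_sub_contribution_le hG hij hr1 hr0 hr).trans ?_
  rw [Finset.sum_const, Finset.sum_const, Finset.card_univ, Finset.card_univ, Fintype.card_finset,
    hcard, nsmul_eq_mul, nsmul_eq_mul]
  push_cast
  rfl

/-- The only use of the hypothesis on the angles: either sine is monotone on the range of the `|θ
l|`, or all `|θ l|` equal the norm. -/
theorem abs_sin_le_abs_sin_norm (h : ‖θ‖ ≤ Real.pi / 2 ∨ ∀ l l' : Fin p, θ l = θ l') (l : Fin p) :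
    |Real.sin (θ l)| ≤ |Real.sin ‖θ‖| := by
  have hl : |θ l| ≤ ‖θ‖ := norm_le_pi_norm θ l
  have habs : |Real.sin (θ l)| = |Real.sin (|θ l|)| := by
    rcases abs_choice (θ l) with h | h <;> rw [h]
    rw [Real.sin_neg, abs_neg]
  rw [habs]
  rcases h with h | h
  · have hpi := Real.pi_pos
    have h0 := abs_nonneg (θ l)
    rw [abs_of_nonneg (Real.sin_nonneg_of_nonneg_of_le_pi h0 (by linarith)),
      abs_of_nonneg (Real.sin_nonneg_of_nonneg_of_le_pi (norm_nonneg θ) (by linarith))]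
    exact Real.sin_le_sin_of_le_of_le_pi_div_two (by linarith) h hl
  · have : ‖θ‖ = |θ l| := le_antisymm
      ((pi_norm_le_iff_of_nonneg (abs_nonneg _)).2 fun l' => by rw [h l' l]; rfl) hl
    rw [this]

end Ansatz

end ZY

theorem proposition1 {V : Type*} [Fintype V] [DecidableEq V] (p : ℕ) :
    ∃ C : ℝ, ∀ (G : SimpleGraph V), G.Connected →
      ∀ (A : ZY.Ansatz G p) (i j : V), G.Adj i j → ∀ k : ℕ,
        (∀ θ : Fin p → ℝ, (‖θ‖ ≤ Real.pi / 2 ∨ ∀ l l' : Fin p, θ l = θ l') →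
          ‖A.kLocalExpectation θ i j k - A.expectation θ i j‖
            ≤ C * |Real.sin ‖θ‖| ^ (2 * k + 1)) ∧
        (∀ (θ : Fin p → ℝ) (v : Finset V) (s : A.Path),
          A.contribution θ i j v s ≠ 0 → A.Truncated i j k s →
            ZY.TwoEdgeConnected (A.relevantGraph i j s) ∧
              2 * k + 2 ≤ (A.relevantGraph i j s).edgeSet.ncard) := by
  -- The factors count the sets `v`, the paths, and the error per path, with the number of gates
  -- replaced by its bound from `numGates_le`.
  refine ⟨2 ^ Fintype.card V * ((4 ^ Fintype.card V) ^ (p * Fintype.card (Sym2 V) + 1) *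
    (4 ^ Fintype.card V * ((p * Fintype.card (Sym2 V) : ℕ) + 1))), fun G hG A i j hij k =>
    ⟨fun θ hθ => ?_, fun θ v s hc ht => ?_⟩⟩
  · refine (ZY.Ansatz.norm_kLocalExpectation_sub_expectation_le hG hij (Real.abs_sin_le_one _)
      (abs_nonneg _) (ZY.Ansatz.abs_sin_le_abs_sin_norm hθ)).trans ?_
    simp only [mul_assoc]
    have hL := A.numGates_le
    have h4 : (1 : ℝ) ≤ 4 ^ Fintype.card V := one_le_pow₀ (by norm_num)
    gcongr
  · have hs := ZY.Ansatz.isAllowed_of_contribution_ne_zero hc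
    refine ⟨hs.twoEdgeConnected hij.ne, ?_⟩
    rw [ZY.Ansatz.ncard_edgeSet_relevantGraph]
    have := hs.two_mul_add_one_le_card_relevantGates hG hij ht
    omega
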